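/- Let $K$ be a field of characteristic $0$ (for example $\mathbb{R}$, or $\mathbb{Q}(\kappa)$ with $\kappa$ an indeterminate) and let $\kappa\in K$ with $\kappa\notin\{-1,-2,-3,\ldots\}$. Write $(a)_n=\prod_{i=1}^{n}(a+i-1)$. For $N\ge 2$ define the polynomials $p_{mn}\in K[x_1,\ldots,x_N]$ ($m,n\ge 0$) by the generating function $$\sum_{m,n=0}^{\infty}p_{mn}(x)s^mt^n=(1-sx_1)^{-1}(1-tx_2)^{-1}\prod_{i=1}^{N}\bigl((1-sx_i)(1-tx_i)\bigr)^{-\kappa},$$ and for $m\ge n\ge 0$ let $$\omega_{mn}=p_{mn}+\sum_{j=1}^{n}\frac{(-\kappa)_j\,(m-n+1)_{j-1}}{(\kappa+m-n+1)_j\,j!}\bigl((m-n+j)\,p_{m+j,n-j}+j\,p_{n-j,m+j}\bigr).$$ Also, for $m\ge n\ge 0$, let $$f_{mn}(x_1,x_2)=(x_1x_2)^n\sum_{j=0}^{m-n}\frac{(\kappa+1)_{m-n-j}\,(\kappa)_j}{(m-n-j)!\,j!}\,x_1^{m-n-j}x_2^{j}.$$ Then for $N=2$ and all integers $m\ge n\ge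 0$, $$\omega_{mn}=\frac{(2\kappa+m-n+1)_n\,(\kappa+1)_n}{(\kappa+m-n+1)_n\,n!}\,f_{mn}.$$ -/

import Mathlib

noncomputable section

namespace NonsymmetricJack

variable {K : Type*} [Field K] [CharZero K]

/-- The Pochhammer symbol `(a)_n = a (a + 1) ⋯ (a + n - 1)`. -/
def poch (a : K) (n : ℕ) : K := (ascPochhammer K n).eval a

/-- The formal power series `(1 - y z)^(-a)` in the variable `z`: Mathlib's binomial series
`(1 + z)^(-a)` after the rescaling `z ↦ -y z`. -/
def negPow {N : ℕ} (y : MvPolynomial (Fin N) K) (a : K) : PowerSeries (MvPolynomial (Fin N) K) :=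
  PowerSeries.rescale (-y) (PowerSeries.binomialSeries (MvPolynomial (Fin N) K) (-a))

/-- A power series in `s`, regarded as an element of `K[x]⟦s⟧⟦t⟧`. -/
def inS {N : ℕ} :
    PowerSeries (MvPolynomial (Fin N) K) →+* PowerSeries (PowerSeries (MvPolynomial (Fin N) K)) :=
  PowerSeries.C

/-- A power series in one variable, read as a power series in `t`, an element of `K[x]⟦s⟧⟦t⟧`. -/
def inT {N : ℕ} :
    PowerSeries (MvPolynomial (Fin N) K) →+* PowerSeries (PowerSeries (MvPolynomial (Fin N) K)) :=
  PowerSeries.map PowerSeries.C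

/-- The generating function
`(1 - s x₁)⁻¹ (1 - t x₂)⁻¹ ∏ i, ((1 - s x_i) (1 - t x_i))^(-κ)` in `K[x₁, …, x_N]⟦s⟧⟦t⟧`.
The variables `x₁, x₂` are `X 0, X 1`. -/
def genFun (N : ℕ) [N.AtLeastTwo] (κ : K) : PowerSeries (PowerSeries (MvPolynomial (Fin N) K)) :=
  inS (negPow (MvPolynomial.X 0) 1) * inT (negPow (MvPolynomial.X 1) 1) *
    ∏ i : Fin N, (inS (negPow (MvPolynomial.X i) κ) * inT (negPow (MvPolynomial.X i) κ))

/-- `p_{mn}`, the coefficient of `s^m t^n` in the generating function. -/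
def p (N : ℕ) [N.AtLeastTwo] (κ : K) (m n : ℕ) : MvPolynomial (Fin N) K :=
  PowerSeries.coeff m (PowerSeries.coeff n (genFun N κ))

/-- The formula for `ω_{mn}` in the case `m ≥ n`. -/
def omegaOfGE (N : ℕ) [N.AtLeastTwo] (κ : K) (m n : ℕ) : MvPolynomial (Fin N) K :=
  p N κ m n + ∑ j ∈ Finset.Icc 1 n,
    MvPolynomial.C (poch (-κ) j * poch ((m : K) - n + 1) (j - 1) /
        (poch (κ + m - n + 1) j * (j.factorial : K))) *
      (MvPolynomial.C ((m : K) - n + j) * p N κ (m + j) (n - j) +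
        MvPolynomial.C (j : K) * p N κ (n - j) (m + j))

/-- The polynomial `ω_{mn}`; for `m < n` it is the image of `ω_{nm}` under the transposition of
`x₁` and `x₂`. -/
def omega (N : ℕ) [N.AtLeastTwo] (κ : K) (m n : ℕ) : MvPolynomial (Fin N) K :=
  if n ≤ m then omegaOfGE N κ m n
  else MvPolynomial.rename (Equiv.swap (0 : Fin N) 1) (omegaOfGE N κ n m)

/-- The polynomial `f_{mn}` in two variables, for `m ≥ n`. -/
def f (κ : K) (m n : ℕ) : MvPolynomial (Fin 2) K :=
  (MvPolynomial.X 0 * MvPolynomial.X 1) ^ n * ∑ j ∈ Finset.range (m - n + 1),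
    MvPolynomial.C (poch (κ + 1) (m - n - j) * poch κ j /
        (((m - n - j).factorial : K) * (j.factorial : K))) *
      MvPolynomial.X 0 ^ (m - n - j) * MvPolynomial.X 1 ^ j

end NonsymmetricJack

end

noncomputable section

namespace NonsymmetricJack

open MvPolynomial

/-! ### Pochhammer symbols and coefficients of binomial series. -/

section PowerSeriesCoefficients

variable {K : Type*} [Field K]

/-! For `N = 2` the generating function splits into a factor in `s` and a factor in `t`, so `p_{mn}`
is a product of two one-index polynomials `edge` (`p_two`), and `f_{mn}` is `(x₁x₂)^n` times a
single one (`f_eq`). Both `ω_{mn}` and `f_{mn}` are homogeneous of degree `m + n` and are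
eigenfunctions of the Cherednik operator with eigenvalue `m` (`cherednik_pairSum`, `cherednik_f`).

When `κ` is a positive integer, the operator is triangular enough that such an eigenfunction is
determined by its coefficient at `x₁^m x₂^n` (`eq_zero_of_cherednik`). Hence `ω_{mn} = c f_{mn}`,
and `c` is read off at `x₁ = x₂ = 1`, where `ω_{mn}` becomes a hypergeometric sum evaluated by
telescoping (`sum_rising_succ`, `eval_one_pairSum`).

After multiplication by `(κ+m-n+1)_n` both sides are polynomial in `κ`; agreeing at all positive
integers, they agree for every `κ` (`IsPolyFun.eq_of_natCast`). -/

lemma poch_zero (a : K) : poch a 0 = 1 := by simp [poch]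

lemma poch_succ (a : K) (n : ℕ) : poch a (n + 1) = poch a n * (a + n) := by
  simp [poch, ascPochhammer_succ_eval]

lemma poch_add (a : K) (m n : ℕ) : poch a (m + n) = poch a m * poch (a + m) n := by
  simp [poch, ← ascPochhammer_mul]

lemma poch_succ_left (a : K) (n : ℕ) : poch a (n + 1) = a * poch (a + 1) n := by
  rw [add_comm, poch_add]; simp [poch]

lemma poch_ne_zero {a : K} {n : ℕ} (h : ∀ i < n, a + (i : K) ≠ 0) : poch a n ≠ 0 := by
  induction n with
  | zero => simp [poch_zero]
  | succ n ih =>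
    rw [poch_succ]
    exact mul_ne_zero (ih fun i hi => h i (by omega)) (h n (by omega))

/-- The coefficient `(a)_n / n!` of `z ^ n` in `(1 - z) ^ (-a)`. -/
def rising (a : K) (n : ℕ) : K := poch a n / (n.factorial : K)

lemma rising_zero (a : K) : rising a 0 = 1 := by simp [rising, poch_zero]

variable [CharZero K]

lemma rising_succ (a : K) (n : ℕ) : ((n : K) + 1) * rising a (n + 1) = (a + n) * rising a n := by
  have h1 : (n.factorial : K) ≠ 0 := by exact_mod_cast n.factorial_ne_zero
  have h2 : (n : K) + 1 ≠ 0 := by exact_mod_cast n.succ_ne_zero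
  rw [rising, rising, poch_succ, Nat.factorial_succ]
  push_cast
  field_simp

lemma rising_succ_left (a : K) (n : ℕ) :
    ((n : K) + 1) * rising a (n + 1) = a * rising (a + 1) n := by
  have h1 : (n.factorial : K) ≠ 0 := by exact_mod_cast n.factorial_ne_zero
  have h2 : (n : K) + 1 ≠ 0 := by exact_mod_cast n.succ_ne_zero
  rw [rising, rising, poch_succ_left, Nat.factorial_succ]
  push_cast
  field_simp

lemma choose_neg_eq_rising (a : K) (n : ℕ) : Ring.choose (-a) n = (-1) ^ n * rising a n := by
  rw [Ring.choose_neg, ← Ring.multichoose_eq, Units.smul_def, zsmul_eq_mul,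
    Int.cast_negOnePow_natCast, rising]
  congr 1
  have h := Ring.factorial_nsmul_multichoose_eq_ascPochhammer a n
  rw [Polynomial.ascPochhammer_smeval_eq_eval] at h
  have h1 : (n.factorial : K) ≠ 0 := by exact_mod_cast n.factorial_ne_zero
  rw [eq_div_iff h1, poch, ← h, nsmul_eq_mul, mul_comm]

lemma sum_rising_mul_rising (a b : K) (n : ℕ) :
    ∑ ij ∈ Finset.HasAntidiagonal.antidiagonal n, rising a ij.1 * rising b ij.2 = rising (a + b) n := by
  have h := Ring.add_choose_eq n (Commute.all (-a) (-b))
  simp only [← neg_add, choose_neg_eq_rising] at h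
  have h1 : ((-1 : K) ^ n) ≠ 0 := pow_ne_zero _ (by simp)
  refine mul_left_cancel₀ h1 ?_
  rw [h, Finset.mul_sum]
  refine Finset.sum_congr rfl fun ij hij => ?_
  rw [← Finset.HasAntidiagonal.mem_antidiagonal.1 hij, pow_add]
  ring

lemma coeff_negPow {N : ℕ} (y : MvPolynomial (Fin N) K) (a : K) (n : ℕ) :
    PowerSeries.coeff n (negPow y a) = C (rising a n) * y ^ n := by
  rw [negPow, PowerSeries.coeff_rescale, PowerSeries.binomialSeries_coeff, choose_neg_eq_rising,
    smul_eq_C_mul, neg_pow]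
  simp only [map_mul, map_pow, map_neg, map_one]
  have : ((-1 : MvPolynomial (Fin N) K) ^ n) * (-1) ^ n = 1 := by
    rw [← mul_pow]; simp
  linear_combination (C (rising a n) * y ^ n) * this

lemma negPow_add {N : ℕ} (y : MvPolynomial (Fin N) K) (a b : K) :
    negPow y (a + b) = negPow y a * negPow y b := by
  rw [negPow, neg_add, PowerSeries.binomialSeries_add, map_mul, negPow, negPow]

lemma negPow_neg_one {N : ℕ} (y : MvPolynomial (Fin N) K) :
    negPow y (-1 : K) = 1 - PowerSeries.C y * PowerSeries.X := by
  have h : PowerSeries.binomialSeries (MvPolynomial (Fin N) K) (1 : K) = 1 + PowerSeries.X := by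
    simpa using PowerSeries.binomialSeries_nat (R := K) (A := MvPolynomial (Fin N) K) 1
  rw [negPow, neg_neg, h]
  simp [PowerSeries.rescale_X, sub_eq_add_neg]

/-! ### The two-variable factors of `p` and `f`. -/

/-- The coefficient of `s ^ n` in `(1 - s x_u)^(-κ-1) (1 - s x_v)^(-κ)`. -/
def edge (κ : K) (u v : Fin 2) (n : ℕ) : MvPolynomial (Fin 2) K :=
  PowerSeries.coeff n (negPow (X u) (κ + 1) * negPow (X v) κ)

/-- The coefficient of `s ^ n` in `((1 - s x₁) (1 - s x₂))^(-κ-1)`. -/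
def gegen (κ : K) (n : ℕ) : MvPolynomial (Fin 2) K :=
  PowerSeries.coeff n (negPow (X 0) (κ + 1) * negPow (X 1) (κ + 1))

/-- The coefficient of `s ^ n` in `s ((1 - s x₁) (1 - s x₂))^(-κ-1)`. -/
def gegenPred (κ : K) (n : ℕ) : MvPolynomial (Fin 2) K :=
  PowerSeries.coeff n (PowerSeries.X * (negPow (X 0) (κ + 1) * negPow (X 1) (κ + 1)))

lemma gegenPred_zero (κ : K) : gegenPred κ 0 = 0 := by simp [gegenPred]

lemma gegenPred_succ (κ : K) (n : ℕ) : gegenPred κ (n + 1) = gegen κ n := by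
  rw [gegenPred, PowerSeries.coeff_succ_X_mul, gegen]

lemma negPow_eq_mul {N : ℕ} (y : MvPolynomial (Fin N) K) (κ : K) :
    negPow y κ = (1 - PowerSeries.C y * PowerSeries.X) * negPow y (κ + 1) := by
  rw [← negPow_neg_one, ← negPow_add]; congr 1; ring

lemma edge_zero_one (κ : K) (n : ℕ) : edge κ 0 1 n = gegen κ n - X 1 * gegenPred κ n := by
  rw [edge, gegen, gegenPred, negPow_eq_mul (X 1) κ, ← PowerSeries.coeff_C_mul, ← map_sub]
  congr 1; ring

lemma edge_one_zero (κ : K) (n : ℕ) : edge κ 1 0 n = gegen κ n - X 0 * gegenPred κ n := by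
  rw [edge, gegen, gegenPred, negPow_eq_mul (X 0) κ, ← PowerSeries.coeff_C_mul, ← map_sub]
  congr 1; ring

lemma edge_eq_sum (κ : K) (u v : Fin 2) (n : ℕ) :
    edge κ u v n = ∑ ij ∈ Finset.HasAntidiagonal.antidiagonal n,
      (C (rising (κ + 1) ij.1) * X u ^ ij.1) * (C (rising κ ij.2) * X v ^ ij.2) := by
  simp only [edge, PowerSeries.coeff_mul, coeff_negPow]

lemma gegen_eq_sum (κ : K) (u v : Fin 2) (huv : u ≠ v) (n : ℕ) :
    gegen κ n = ∑ ij ∈ Finset.HasAntidiagonal.antidiagonal n,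
      (C (rising (κ + 1) ij.1) * X u ^ ij.1) * (C (rising (κ + 1) ij.2) * X v ^ ij.2) := by
  have : gegen κ n =
      PowerSeries.coeff n (negPow (X u) (κ + 1) * negPow (X v) (κ + 1)) := by
    fin_cases u <;> fin_cases v <;> simp_all [gegen, mul_comm]
  simp only [this, PowerSeries.coeff_mul, coeff_negPow]

lemma p_two (κ : K) (m n : ℕ) : p 2 κ m n = edge κ 0 1 m * edge κ 1 0 n := by
  have h : genFun 2 κ = inS (negPow (X 0) (κ + 1) * negPow (X 1) κ) *
      inT (negPow (X 1) (κ + 1) * negPow (X 0) κ) := by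
    rw [genFun, Fin.prod_univ_two, negPow_add, negPow_add]
    simp only [map_mul]
    ring
  rw [p, h, inS, inT, PowerSeries.coeff_C_mul, PowerSeries.coeff_map, PowerSeries.coeff_mul_C]
  rfl

lemma edge_isHomogeneous (κ : K) (u v : Fin 2) (n : ℕ) : (edge κ u v n).IsHomogeneous n := by
  rw [edge_eq_sum]
  refine IsHomogeneous.sum _ _ _ fun ij hij => ?_
  rw [← Finset.HasAntidiagonal.mem_antidiagonal.1 hij]
  refine IsHomogeneous.mul ?_ ?_
  · simpa using (isHomogeneous_C (Fin 2) (rising (κ + 1) ij.1)).mul (isHomogeneous_X_pow u ij.1)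
  · simpa using (isHomogeneous_C (Fin 2) (rising κ ij.2)).mul (isHomogeneous_X_pow v ij.2)

lemma rename_swap_edge (κ : K) (u v : Fin 2) (n : ℕ) :
    rename (Equiv.swap (0 : Fin 2) 1) (edge κ u v n) =
      edge κ (Equiv.swap 0 1 u) (Equiv.swap 0 1 v) n := by
  simp [edge_eq_sum]

/-- Differentiating `(1 - s x_v)^(-κ)` in `x_v` gives `κ s (1 - s x_v)^(-κ-1)`, which makes the
generating function symmetric. -/
lemma pderiv_edge (κ : K) (u v : Fin 2) (huv : u ≠ v) (n : ℕ) :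
    pderiv v (edge κ u v n) = C κ * gegenPred κ n := by
  cases n with
  | zero => simp [edge_eq_sum, gegenPred_zero, rising_zero]
  | succ n =>
    rw [gegenPred_succ, gegen_eq_sum κ u v huv, edge_eq_sum, map_sum,
      Finset.Nat.sum_antidiagonal_succ', Finset.mul_sum]
    simp only [pderiv_mul, pderiv_C, pderiv_pow, pderiv_X_of_ne huv, pderiv_X_self]
    simp only [pow_zero, mul_zero, zero_mul, add_zero, zero_add, mul_one, Nat.cast_zero,
      Nat.add_sub_cancel]
    refine Finset.sum_congr rfl fun ij _ => ?_
    have h := congrArg (C (σ := Fin 2)) (rising_succ_left κ ij.2)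
    simp only [map_mul, map_add, map_natCast, map_one] at h
    push_cast
    linear_combination (C (rising (κ + 1) ij.1) * X u ^ ij.1 * X v ^ ij.2) * h

/-- At `x₁ = x₂ = 1` the generating function collapses to `(1 - s)^(-2κ-1)`. -/
lemma eval_one_edge (κ : K) (u v : Fin 2) (n : ℕ) :
    eval (fun _ => 1) (edge κ u v n) = rising (2 * κ + 1) n := by
  rw [edge_eq_sum, show 2 * κ + 1 = (κ + 1) + κ by ring, ← sum_rising_mul_rising]
  simp

lemma f_eq (κ : K) (n d : ℕ) : f κ (n + d) n = (X 0 * X 1) ^ n * edge κ 0 1 d := by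
  rw [f, edge_eq_sum, Finset.Nat.sum_antidiagonal_eq_sum_range_succ_mk,
    ← Finset.sum_range_reflect]
  congr 1
  rw [Nat.add_sub_cancel_left]
  refine Finset.sum_congr rfl fun j hj => ?_
  have hj : j ≤ d := Nat.lt_succ_iff.1 (Finset.mem_range.1 hj)
  have h1 : d + 1 - 1 - j = d - j := by omega
  have h2 : d - (d - j) = j := by omega
  simp only [h1, h2, rising, mul_div_mul_comm, map_mul]
  ring

end PowerSeriesCoefficients

/-! ### The Cherednik operator and uniqueness of its eigenfunctions. -/

section CherednikOperator

variable {K : Type*} [Field K]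

/-- The operator `(x₁ - x₂) (x₁ ∂₁ + κ x₂ (1 - σ) / (x₁ - x₂))`, where `σ` exchanges `x₁` and `x₂`:
the Cherednik operator, cleared of its denominator. -/
def cherednik (κ : K) : MvPolynomial (Fin 2) K →ₗ[K] MvPolynomial (Fin 2) K :=
  LinearMap.mulLeft K ((X 0 - X 1) * X 0) ∘ₗ (pderiv 0).toLinearMap +
    LinearMap.mulLeft K (C κ * X 1) ∘ₗ
      (LinearMap.id - (rename (Equiv.swap (0 : Fin 2) 1)).toLinearMap)

lemma cherednik_apply (κ : K) (P : MvPolynomial (Fin 2) K) :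
    cherednik κ P = (X 0 - X 1) * X 0 * pderiv 0 P +
      C κ * X 1 * (P - rename (Equiv.swap (0 : Fin 2) 1) P) := rfl

lemma cherednik_C_mul (κ c : K) (P : MvPolynomial (Fin 2) K) :
    cherednik κ (C c * P) = C c * cherednik κ P := by
  rw [← smul_eq_C_mul, map_smul, smul_eq_C_mul]

lemma cherednik_mul_pow (κ : K) (P : MvPolynomial (Fin 2) K) (n : ℕ) :
    cherednik κ ((X 0 * X 1) ^ n * P) =
      (X 0 * X 1) ^ n * (cherednik κ P + (n : MvPolynomial (Fin 2) K) * (X 0 - X 1) * P) := by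
  cases n with
  | zero => simp
  | succ n =>
    simp only [cherednik_apply, pderiv_mul, pderiv_pow, map_mul, map_pow, rename_X,
      Equiv.swap_apply_left, Equiv.swap_apply_right, pderiv_X_self, Nat.add_sub_cancel,
      pderiv_X_of_ne (one_ne_zero : (1 : Fin 2) ≠ 0)]
    ring

/-- The exponent of the monomial `x₁ ^ i x₂ ^ j`. -/
def expo (i j : ℕ) : Fin 2 →₀ ℕ := Finsupp.single 0 i + Finsupp.single 1 j

lemma expo_apply_zero (i j : ℕ) : expo i j 0 = i := by simp [expo]

lemma expo_eq (e : Fin 2 →₀ ℕ) : e = expo (e 0) (e 1) := by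
  ext i; fin_cases i <;> simp [expo]

lemma coeff_expo_X_zero_mul (P : MvPolynomial (Fin 2) K) (i j : ℕ) :
    coeff (expo (i + 1) j) (X 0 * P) = coeff (expo i j) P := by
  rw [show expo (i + 1) j = Finsupp.single 0 1 + expo i j by
    rw [expo, Finsupp.single_add, expo]; abel, coeff_X_mul]

lemma coeff_expo_X_one_mul (P : MvPolynomial (Fin 2) K) (i j : ℕ) :
    coeff (expo i (j + 1)) (X 1 * P) = coeff (expo i j) P := by
  rw [show expo i (j + 1) = Finsupp.single 1 1 + expo i j by
    rw [expo, Finsupp.single_add, expo]; abel, coeff_X_mul]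

lemma coeff_expo_zero_X_zero_mul (P : MvPolynomial (Fin 2) K) (j : ℕ) :
    coeff (expo 0 j) (X 0 * P) = 0 := by
  rw [coeff_X_mul', if_neg (by simp [expo])]

lemma coeff_expo_zero_X_one_mul (P : MvPolynomial (Fin 2) K) (i : ℕ) :
    coeff (expo i 0) (X 1 * P) = 0 := by
  rw [coeff_X_mul', if_neg (by simp [expo])]

lemma coeff_expo_X_mul_pderiv (P : MvPolynomial (Fin 2) K) (i j : ℕ) :
    coeff (expo i j) (X 0 * pderiv 0 P) = i * coeff (expo i j) P := by
  cases i with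
  | zero => simp [coeff_expo_zero_X_zero_mul]
  | succ i =>
    rw [coeff_expo_X_zero_mul, coeff_pderiv, expo_apply_zero, mul_comm]
    congr 2
    · push_cast; rfl
    · rw [expo, expo, Finsupp.single_add]; abel_nf

lemma coeff_expo_rename_swap (P : MvPolynomial (Fin 2) K) (i j : ℕ) :
    coeff (expo i j) (rename (Equiv.swap (0 : Fin 2) 1) P) = coeff (expo j i) P := by
  rw [← coeff_rename_mapDomain _ (Equiv.swap (0 : Fin 2) 1).injective P (expo j i)]
  congr 1
  simp [expo, Finsupp.mapDomain_add, Finsupp.mapDomain_single, add_comm]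

/-- A homogeneous polynomial annihilated by `cherednik κ - m (x₁ - x₂)` is determined by its
coefficient at `x₁ ^ m x₂ ^ n`. -/
lemma eq_zero_of_cherednik [CharZero K] (k : ℕ) (hk : 0 < k) (m n : ℕ) (hmn : n ≤ m)
    (P : MvPolynomial (Fin 2) K) (hP : P.IsHomogeneous (m + n))
    (hU : cherednik (k : K) P = C (m : K) * (X 0 - X 1) * P)
    (hc : coeff (expo m n) P = 0) : P = 0 := by
  obtain ⟨Q, hQ⟩ : ∃ Q, Q = X 0 * pderiv 0 P := ⟨_, rfl⟩
  have hQc : ∀ i j, coeff (expo i j) Q = i * coeff (expo i j) P := fun i j => by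
    rw [hQ, coeff_expo_X_mul_pderiv]
  have hrel : X 0 * Q - X 1 * Q +
      C (k : K) * (X 1 * P - X 1 * rename (Equiv.swap (0 : Fin 2) 1) P) =
      C (m : K) * (X 0 * P - X 1 * P) := by
    rw [cherednik_apply, mul_assoc, ← hQ] at hU
    linear_combination hU
  -- Induction from the outermost monomials inwards. At each level the coefficient of `x₁^j x₂^i` is
  -- killed by the factor `j - m` (or is the given one if `j = m`); then that of `x₁^i x₂^j` is
  -- killed by `m - i + k`, which is positive because `i ≤ m` and `k > 0`.
  have key : ∀ i j : ℕ, i ≤ j → i + j = m + n →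
      coeff (expo j i) P = 0 ∧ coeff (expo i j) P = 0 := by
    intro i
    induction i with
    | zero =>
      intro j _ hj
      have h1 : coeff (expo j 0) P = 0 := by
        rcases Nat.eq_zero_or_pos n with rfl | hn
        · rwa [show j = m by omega]
        have h := congrArg (coeff (expo (j + 1) 0)) hrel
        simp only [coeff_add, coeff_sub, coeff_C_mul, coeff_expo_X_zero_mul,
          coeff_expo_zero_X_one_mul, hQc] at h
        have hne : (n : K) ≠ 0 := by exact_mod_cast hn.ne'
        have hj' : (j : K) = m + n := by exact_mod_cast (by omega : j = m + n)
        rw [hj'] at h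
        refine (mul_eq_zero.1 ?_).resolve_left hne
        linear_combination h
      refine ⟨h1, ?_⟩
      have h := congrArg (coeff (expo 0 (j + 1))) hrel
      simp only [coeff_add, coeff_sub, coeff_C_mul, coeff_expo_X_one_mul,
        coeff_expo_zero_X_zero_mul, hQc, coeff_expo_rename_swap, h1] at h
      have hne : (m : K) + k ≠ 0 := by exact_mod_cast (by omega : m + k ≠ 0)
      refine (mul_eq_zero.1 ?_).resolve_left hne
      linear_combination h
    | succ i ih =>
      intro j hij hj
      obtain ⟨ih1, ih2⟩ := ih (j + 1) (by omega) (by omega)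
      have h1 : coeff (expo j (i + 1)) P = 0 := by
        rcases eq_or_ne j m with rfl | hjm
        · rwa [show i + 1 = n by omega]
        have h := congrArg (coeff (expo (j + 1) (i + 1))) hrel
        simp only [coeff_add, coeff_sub, coeff_C_mul, coeff_expo_X_zero_mul,
          coeff_expo_X_one_mul, hQc, coeff_expo_rename_swap, ih1, ih2] at h
        have hne : (j : K) - m ≠ 0 := sub_ne_zero.2 (by exact_mod_cast hjm)
        refine (mul_eq_zero.1 ?_).resolve_left hne
        linear_combination h
      refine ⟨h1, ?_⟩
      have h := congrArg (coeff (expo (i + 1) (j + 1))) hrel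
      simp only [coeff_add, coeff_sub, coeff_C_mul, coeff_expo_X_zero_mul,
        coeff_expo_X_one_mul, hQc, coeff_expo_rename_swap, ih2, h1] at h
      obtain ⟨r, hr⟩ : ∃ r, m = i + 1 + r := ⟨m - (i + 1), by omega⟩
      have hne : (r : K) + k ≠ 0 := by exact_mod_cast (by omega : r + k ≠ 0)
      refine (mul_eq_zero.1 ?_).resolve_left hne
      rw [hr] at h
      push_cast at h
      linear_combination h
  ext e
  rw [coeff_zero]
  by_cases he : e.degree = m + n
  · rw [expo_eq e]
    have he' : e 0 + e 1 = m + n := by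
      rw [← he, Finsupp.degree_eq_sum, Fin.sum_univ_two]
    rcases le_total (e 0) (e 1) with h | h
    · exact (key _ _ h he').2
    · exact (key _ _ h (by omega)).1
  · exact hP.coeff_eq_zero he

/-! ### Explicit eigenfunctions and the sum at `(1, 1)`. -/

variable [CharZero K]

/-- Euler's identity trades `x₁ ∂₁` of the first factor for its degree and `x₂ ∂₂`, which
`pderiv_edge` computes. A product is thus an eigenfunction up to a defect that involves only the
symmetric polynomials `gegen` and `gegenPred`. -/
lemma cherednik_edge_mul_edge (κ : K) (i k : ℕ) :
    cherednik κ (edge κ 0 1 i * edge κ 1 0 k) =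
      (X 0 - X 1) * ((i : MvPolynomial (Fin 2) K) * (edge κ 0 1 i * edge κ 1 0 k) +
        C κ * (X 0 - X 1) * (gegen κ i * gegenPred κ k)) := by
  have hE := (edge_isHomogeneous κ 0 1 i).sum_X_mul_pderiv
  rw [Fin.sum_univ_two, pderiv_edge κ 0 1 (by simp), nsmul_eq_mul] at hE
  simp only [cherednik_apply, pderiv_mul, map_mul, rename_swap_edge, Equiv.swap_apply_left,
    Equiv.swap_apply_right, pderiv_edge κ 1 0 (by simp)]
  have h1 := edge_zero_one κ i
  have h2 := edge_zero_one κ k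
  have h3 := edge_one_zero κ i
  have h4 := edge_one_zero κ k
  have hE' : X 0 * pderiv 0 (edge κ 0 1 i) =
      (i : MvPolynomial (Fin 2) K) * edge κ 0 1 i - X 1 * (C κ * gegenPred κ i) := by
    linear_combination hE
  have : (X 0 - X 1) * X 0 * (pderiv 0 (edge κ 0 1 i) * edge κ 1 0 k +
        edge κ 0 1 i * (C κ * gegenPred κ k)) +
      C κ * X 1 * (edge κ 0 1 i * edge κ 1 0 k - edge κ 1 0 i * edge κ 0 1 k) =
      (X 0 - X 1) * (((i : MvPolynomial (Fin 2) K) * edge κ 0 1 i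
        - X 1 * (C κ * gegenPred κ i)) * edge κ 1 0 k +
        X 0 * edge κ 0 1 i * (C κ * gegenPred κ k)) +
      C κ * X 1 * (edge κ 0 1 i * edge κ 1 0 k - edge κ 1 0 i * edge κ 0 1 k) := by
    rw [← hE']; ring
  rw [this, h1, h2, h3, h4]
  ring

/-- The combination of products that is an eigenfunction for suitable coefficients. -/
def pairSum (κ : K) (α β : ℕ → K) (d n : ℕ) : MvPolynomial (Fin 2) K :=
  ∑ j ∈ Finset.range (n + 1),
    (C (α j) * (edge κ 0 1 (n + d + j) * edge κ 1 0 (n - j)) +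
      C (β j) * (edge κ 0 1 (n - j) * edge κ 1 0 (n + d + j)))

lemma pairSum_isHomogeneous (κ : K) (α β : ℕ → K) (d n : ℕ) :
    (pairSum κ α β d n).IsHomogeneous (n + d + n) := by
  refine IsHomogeneous.sum _ _ _ fun j hj => ?_
  have hj : j ≤ n := Nat.lt_succ_iff.1 (Finset.mem_range.1 hj)
  have h1 := (isHomogeneous_C (Fin 2) (α j)).mul
    ((edge_isHomogeneous κ 0 1 (n + d + j)).mul (edge_isHomogeneous κ 1 0 (n - j)))
  have h2 := (isHomogeneous_C (Fin 2) (β j)).mul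
    ((edge_isHomogeneous κ 0 1 (n - j)).mul (edge_isHomogeneous κ 1 0 (n + d + j)))
  rw [show 0 + (n + d + j + (n - j)) = n + d + n by omega] at h1
  rw [show 0 + (n - j + (n + d + j)) = n + d + n by omega] at h2
  exact h1.add h2

/-- The recurrences make the defects of the products telescope: since `gegenPred` is `gegen` shifted
by one, the first part of the defect at `j + 1` cancels the second part at `j`. The ends vanish by
`β 0 = 0` and `gegenPred κ 0 = 0`. -/
lemma cherednik_pairSum (κ : K) (α β : ℕ → K) (d n : ℕ) (hβ0 : β 0 = 0)
    (hαβ : ∀ j : ℕ, ((d : K) + j) * β j = j * α j)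
    (hβα : ∀ j : ℕ, (κ + d + j + 1) * β (j + 1) = (j - κ) * α j) :
    cherednik κ (pairSum κ α β d n) =
      C ((n + d : ℕ) : K) * (X 0 - X 1) * pairSum κ α β d n := by
  have key : ∀ j ∈ Finset.range (n + 1),
      cherednik κ (C (α j) * (edge κ 0 1 (n + d + j) * edge κ 1 0 (n - j)) +
        C (β j) * (edge κ 0 1 (n - j) * edge κ 1 0 (n + d + j))) -
      C ((n + d : ℕ) : K) * (X 0 - X 1) *
        (C (α j) * (edge κ 0 1 (n + d + j) * edge κ 1 0 (n - j)) +
        C (β j) * (edge κ 0 1 (n - j) * edge κ 1 0 (n + d + j))) =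
      (X 0 - X 1) ^ 2 *
        (C (j * α j + κ * β j) * (gegenPred κ (n + d + j) * gegen κ (n - j)) -
          C ((j - κ) * α j) * (gegen κ (n + d + j) * gegenPred κ (n - j))) := by
    intro j hj
    have hj : j ≤ n := Nat.lt_succ_iff.1 (Finset.mem_range.1 hj)
    have h := congrArg (C (σ := Fin 2)) (hαβ j)
    simp only [map_mul, map_add, map_natCast] at h
    simp only [map_add, cherednik_C_mul, cherednik_edge_mul_edge, map_mul, map_sub, map_natCast,
      Nat.cast_add, Nat.cast_sub hj]
    simp only [edge_zero_one, edge_one_zero]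
    linear_combination (-(X 0 - X 1) * ((gegen κ (n - j) - X 1 * gegenPred κ (n - j)) *
      (gegen κ (n + d + j) - X 0 * gegenPred κ (n + d + j)))) * h
  rw [← sub_eq_zero, pairSum, map_sum, Finset.mul_sum, ← Finset.sum_sub_distrib,
    Finset.sum_congr rfl key, ← Finset.mul_sum, Finset.sum_sub_distrib, Finset.sum_range_succ',
    Finset.sum_range_succ _ n, Nat.sub_self, gegenPred_zero, hβ0]
  simp only [mul_zero, add_zero, Nat.cast_zero, zero_mul, map_zero]
  refine mul_eq_zero_of_right _ (sub_eq_zero.2 ?_)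
  refine Finset.sum_congr rfl fun j hj => ?_
  have hj : j < n := Finset.mem_range.1 hj
  rw [← add_assoc, gegenPred_succ, show n - j = n - (j + 1) + 1 by omega, gegenPred_succ,
    ← hβα, ← hαβ]
  congr 2
  push_cast
  ring

/-- Pairing `edge κ 0 1 d` with `edge κ 1 0 0 = 1` leaves no defect, so it has eigenvalue `d`; the
factor `(x₁x₂)^n` raises this by `n`. -/
lemma cherednik_f (κ : K) (d n : ℕ) :
    cherednik κ (f κ (n + d) n) = C ((n + d : ℕ) : K) * (X 0 - X 1) * f κ (n + d) n := by
  have h := cherednik_edge_mul_edge κ d 0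
  have h0 : edge κ 1 0 0 = 1 := by simp [edge_eq_sum, rising_zero]
  rw [gegenPred_zero, h0, mul_one] at h
  rw [f_eq, cherednik_mul_pow, h]
  simp only [Nat.cast_add, map_add, map_natCast]
  ring

lemma f_isHomogeneous (κ : K) (d n : ℕ) : (f κ (n + d) n).IsHomogeneous (n + d + n) := by
  rw [f_eq]
  have h := (((isHomogeneous_X K (0 : Fin 2)).mul (isHomogeneous_X K (1 : Fin 2))).pow n).mul
    (edge_isHomogeneous κ 0 1 d)
  rwa [show (1 + 1) * n + d = n + d + n by ring] at h

lemma eval_one_f (κ : K) (d n : ℕ) :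
    eval (fun _ => 1) (f κ (n + d) n) = rising (2 * κ + 1) d := by
  simp [f_eq, eval_one_edge]

/-- The terminating very-well-poised summation, up to its value at `n = 0`. -/
lemma sum_rising_succ (κ : K) (α β : ℕ → K) (d n : ℕ)
    (hβ0 : β 0 = 0) (hαβ : ∀ j : ℕ, ((d : K) + j) * β j = j * α j)
    (hβα : ∀ j : ℕ, (κ + d + j + 1) * β (j + 1) = (j - κ) * α j) :
    (κ + d + 1 + n) * (n + 1) * ∑ j ∈ Finset.range (n + 1 + 1),
        (α j + β j) * (rising (2 * κ + 1) (n + 1 + d + j) * rising (2 * κ + 1) (n + 1 - j)) =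
      (2 * κ + 1 + n + d) * (κ + 1 + n) * ∑ j ∈ Finset.range (n + 1),
        (α j + β j) * (rising (2 * κ + 1) (n + d + j) * rising (2 * κ + 1) (n - j)) := by
  set h : ℕ → K := rising (2 * κ + 1) with hh
  have hsucc : ∀ i : ℕ, h (i + 1) = (2 * κ + 1 + i) * h i / (i + 1) := fun i => by
    rw [eq_div_iff (Nat.cast_add_one_ne_zero i), ← rising_succ, mul_comm]
  -- A telescoping certificate in the style of Zeilberger: the recurrence in `n` holds termwise up
  -- to `G (j + 1) - G j`. The factor `β j` gives `G 0 = 0`, and the extra term `j = n + 1` of the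
  -- longer sum cancels `G (n + 1)`.
  set G : ℕ → K := fun j =>
    -(2 * κ + d + 2 * n + 2) * (β j * (d + j + κ)) * (h (n + d + j) * h (n + 1 - j)) with hG
  have step : ∀ j ∈ Finset.range (n + 1),
      (κ + d + 1 + n) * (n + 1) * ((α j + β j) * (h (n + 1 + d + j) * h (n + 1 - j))) -
        (2 * κ + 1 + n + d) * (κ + 1 + n) * ((α j + β j) * (h (n + d + j) * h (n - j))) =
      G (j + 1) - G j := by
    intro j hj
    obtain ⟨r, rfl⟩ : ∃ r, n = j + r :=
      ⟨n - j, by have := Finset.mem_range.1 hj; omega⟩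
    have hN : ((j + r + d + j : ℕ) : K) + 1 ≠ 0 := Nat.cast_add_one_ne_zero _
    have hr : (r : K) + 1 ≠ 0 := Nat.cast_add_one_ne_zero r
    have e1 : β (j + 1) * (d + ((j + 1 : ℕ) : K) + κ) = (j - κ) * α j := by
      rw [← hβα]; push_cast; ring
    simp only [hG]
    rw [e1, show j + r + 1 + d + j = j + r + d + j + 1 by ring,
      show j + r + d + (j + 1) = j + r + d + j + 1 by ring,
      show j + r + 1 - j = r + 1 by omega, show j + r - j = r by omega,
      show j + r + 1 - (j + 1) = r by omega, hsucc (j + r + d + j), hsucc r]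
    push_cast at hN ⊢
    field_simp
    linear_combination (-((2 * κ + 2 * j + r + 1 + d) ^ 2 * (2 * κ + r + 1) +
      (2 * κ + 2 * j + r + 1 + d) * ((r + 1) ^ 2 - 2 * κ ^ 2 - 2 * κ * j) -
      2 * κ * (r + 1) * (κ + j + r + 1)) * h (j + r + d + j) * h r) * hαβ j
  have hsum := Finset.sum_congr rfl step
  rw [Finset.sum_range_sub, Finset.sum_sub_distrib, ← Finset.mul_sum, ← Finset.mul_sum] at hsum
  have hG0 : G 0 = 0 := by simp [hG, hβ0]
  have hlast : (κ + d + 1 + n) * (n + 1) *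
      ((α (n + 1) + β (n + 1)) * (h (n + 1 + d + (n + 1)) * h (n + 1 - (n + 1)))) =
      -G (n + 1) := by
    have hN : ((n + d + (n + 1) : ℕ) : K) + 1 ≠ 0 := Nat.cast_add_one_ne_zero _
    have hα := hαβ (n + 1)
    simp only [hG]
    rw [Nat.sub_self, show n + 1 + d + (n + 1) = n + d + (n + 1) + 1 by ring, hsucc (n + d + (n + 1))]
    push_cast at hN hα ⊢
    field_simp
    linear_combination (-(κ + d + 1 + n) * (2 * κ + d + 2 * n + 2) * h (n + d + (n + 1)) *
      h 0) * hα
  rw [Finset.sum_range_succ, mul_add, hlast]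
  linear_combination hsum - hG0

end CherednikOperator

/-! ### Polynomial dependence on `κ`, and the constant at positive integers. -/

section PolynomialDependence

variable {K : Type*} [Field K]

/-- A polynomial-valued function of the parameter `κ` that depends polynomially on `κ`. -/
def IsPolyFun (F : K → MvPolynomial (Fin 2) K) : Prop :=
  ∃ P : Polynomial (MvPolynomial (Fin 2) K), ∀ κ, F κ = P.eval (C κ)

namespace IsPolyFun

variable {F G : K → MvPolynomial (Fin 2) K}

lemma const (a : MvPolynomial (Fin 2) K) : IsPolyFun fun _ : K => a :=
  ⟨Polynomial.C a, fun κ => by simp⟩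

lemma param : IsPolyFun fun κ : K => (C κ : MvPolynomial (Fin 2) K) :=
  ⟨Polynomial.X, fun κ => by simp⟩

lemma add (hF : IsPolyFun F) (hG : IsPolyFun G) : IsPolyFun fun κ => F κ + G κ := by
  obtain ⟨P, hP⟩ := hF
  obtain ⟨Q, hQ⟩ := hG
  exact ⟨P + Q, fun κ => by simp [hP, hQ]⟩

lemma mul (hF : IsPolyFun F) (hG : IsPolyFun G) : IsPolyFun fun κ => F κ * G κ := by
  obtain ⟨P, hP⟩ := hF
  obtain ⟨Q, hQ⟩ := hG
  exact ⟨P * Q, fun κ => by simp [hP, hQ]⟩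

lemma sum {ι : Type*} (s : Finset ι) {F : ι → K → MvPolynomial (Fin 2) K}
    (hF : ∀ i, IsPolyFun (F i)) : IsPolyFun fun κ => ∑ i ∈ s, F i κ := by
  choose P hP using hF
  exact ⟨∑ i ∈ s, P i, fun κ => by simp [hP, Polynomial.eval_finsetSum]⟩

lemma C_add {a b : K → K} (ha : IsPolyFun fun κ => C (a κ)) (hb : IsPolyFun fun κ => C (b κ)) :
    IsPolyFun fun κ => C (a κ + b κ) := by
  simpa only [map_add] using ha.add hb

lemma C_mul {a b : K → K} (ha : IsPolyFun fun κ => C (a κ)) (hb : IsPolyFun fun κ => C (b κ)) :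
    IsPolyFun fun κ => C (a κ * b κ) := by
  simpa only [map_mul] using ha.mul hb

lemma C_poch {a : K → K} (ha : IsPolyFun fun κ => C (a κ)) (n : ℕ) :
    IsPolyFun fun κ => C (poch (a κ) n) := by
  induction n with
  | zero => simpa only [poch_zero] using const _
  | succ n ih => simpa only [poch_succ] using ih.C_mul (ha.C_add (const _))

lemma C_rising {a : K → K} (ha : IsPolyFun fun κ => C (a κ)) (n : ℕ) :
    IsPolyFun fun κ => C (rising (a κ) n) := by
  simpa only [rising, div_eq_mul_inv] using (ha.C_poch n).C_mul (const _)

end IsPolyFun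

variable [CharZero K]

lemma eval_one_pairSum (κ : K) (α β : ℕ → K) (d n : ℕ) (hα0 : α 0 = 1) (hβ0 : β 0 = 0)
    (hαβ : ∀ j : ℕ, ((d : K) + j) * β j = j * α j)
    (hβα : ∀ j : ℕ, (κ + d + j + 1) * β (j + 1) = (j - κ) * α j) :
    poch (κ + d + 1) n * (n.factorial : K) * eval (fun _ => 1) (pairSum κ α β d n) =
      poch (2 * κ + d + 1) n * poch (κ + 1) n * rising (2 * κ + 1) d := by
  have hS : ∀ n, eval (fun _ => 1) (pairSum κ α β d n) = ∑ j ∈ Finset.range (n + 1),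
      (α j + β j) * (rising (2 * κ + 1) (n + d + j) * rising (2 * κ + 1) (n - j)) := fun n => by
    rw [pairSum, map_sum]
    refine Finset.sum_congr rfl fun j _ => ?_
    simp only [map_add, map_mul, eval_C, eval_one_edge]
    ring
  induction n with
  | zero => simp [hS, poch_zero, rising_zero, hα0, hβ0]
  | succ n ih =>
    have h := sum_rising_succ κ α β d n hβ0 hαβ hβα
    rw [← hS, ← hS] at h
    rw [poch_succ, poch_succ, poch_succ, Nat.factorial_succ]
    push_cast
    linear_combination (poch (κ + d + 1) n * (n.factorial : K)) * h +
      (2 * κ + 1 + n + d) * (κ + 1 + n) * ih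

lemma poch_natCast_add_one_ne_zero (a n : ℕ) : poch ((a : K) + 1) n ≠ 0 :=
  poch_ne_zero fun i _ => by exact_mod_cast (by omega : a + 1 + i ≠ 0)

lemma pairSum_eq (k : ℕ) (hk : 0 < k) (α β : ℕ → K) (d n : ℕ) (hα0 : α 0 = 1) (hβ0 : β 0 = 0)
    (hαβ : ∀ j : ℕ, ((d : K) + j) * β j = j * α j)
    (hβα : ∀ j : ℕ, ((k : K) + d + j + 1) * β (j + 1) = (j - k) * α j) :
    C (poch ((k : K) + d + 1) n) * pairSum (k : K) α β d n =
      C (poch (2 * (k : K) + d + 1) n * poch ((k : K) + 1) n / (n.factorial : K)) *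
        f (k : K) (n + d) n := by
  have huniq := fun P => eq_zero_of_cherednik (K := K) k hk (n + d) n (by omega) P
  have hf1 : eval (fun _ => (1 : K)) (f (k : K) (n + d) n) ≠ 0 := by
    rw [eval_one_f, rising]
    refine div_ne_zero ?_ (by exact_mod_cast d.factorial_ne_zero)
    exact_mod_cast poch_natCast_add_one_ne_zero (K := K) (2 * k) d
  -- If this coefficient vanished, uniqueness would force `f = 0`, contradicting its nonzero value
  -- at `(1, 1)`.
  have hfc : coeff (expo (n + d) n) (f (k : K) (n + d) n) ≠ 0 := fun h =>
    hf1 (by rw [huniq _ (f_isHomogeneous _ d n) (cherednik_f _ d n) h, map_zero])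
  obtain ⟨c, hc⟩ : ∃ c, c * coeff (expo (n + d) n) (f (k : K) (n + d) n) =
      coeff (expo (n + d) n) (pairSum (k : K) α β d n) := ⟨_, div_mul_cancel₀ _ hfc⟩
  have heq : pairSum (k : K) α β d n = C c * f (k : K) (n + d) n := by
    refine sub_eq_zero.1 (huniq _ ?_ ?_ ?_)
    · refine (pairSum_isHomogeneous _ α β d n).sub ?_
      simpa using (isHomogeneous_C (Fin 2) c).mul (f_isHomogeneous (k : K) d n)
    · rw [map_sub, cherednik_C_mul, cherednik_f, cherednik_pairSum _ α β d n hβ0 hαβ hβα]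
      ring
    · rw [coeff_sub, coeff_C_mul, hc, sub_self]
  have hev := eval_one_pairSum (k : K) α β d n hα0 hβ0 hαβ hβα
  rw [heq, map_mul, eval_C, eval_one_f] at hev
  rw [eval_one_f] at hf1
  have hn : (n.factorial : K) ≠ 0 := by exact_mod_cast n.factorial_ne_zero
  rw [heq, ← mul_assoc, ← map_mul]
  congr 2
  rw [eq_div_iff hn]
  refine mul_right_cancel₀ hf1 ?_
  linear_combination hev

/-- `(κ + d + 1)_n ω_{n+d,n}` for `N = 2`, written without denominators in `κ`. -/
def clearedOmega (d n : ℕ) (κ : K) : MvPolynomial (Fin 2) K :=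
  C (poch (κ + d + 1) n) * p 2 κ (n + d) n + ∑ j ∈ Finset.Icc 1 n,
    C (poch (-κ) j * poch ((d : K) + 1) (j - 1) * poch (κ + d + 1 + j) (n - j) *
        ((j.factorial : K))⁻¹) *
      (C ((d : K) + j) * p 2 κ (n + d + j) (n - j) + C (j : K) * p 2 κ (n - j) (n + d + j))

lemma C_poch_mul_omegaOfGE (κ : K) (d n : ℕ) (hκ : ∀ i : ℕ, κ + d + 1 + i ≠ 0) :
    C (poch (κ + d + 1) n) * omegaOfGE 2 κ (n + d) n = clearedOmega d n κ := by
  rw [omegaOfGE, clearedOmega, mul_add, Finset.mul_sum]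
  congr 1
  refine Finset.sum_congr rfl fun j hj => ?_
  have hjn : j ≤ n := (Finset.mem_Icc.1 hj).2
  have h1 : ((n + d : ℕ) : K) - n = d := by push_cast; ring
  have h2 : κ + ((n + d : ℕ) : K) - n + 1 = κ + d + 1 := by push_cast; ring
  have h3 : poch (κ + d + 1) n = poch (κ + d + 1) j * poch (κ + d + 1 + j) (n - j) := by
    rw [← poch_add, Nat.add_sub_cancel' hjn]
  have h4 : poch (κ + d + 1) j ≠ 0 := poch_ne_zero fun i _ => hκ i
  rw [h1, h2, h3, ← mul_assoc, ← map_mul]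
  congr 2
  field_simp

/-- The stray term `p_{mn}` becomes the summand `j = 0`. There the truncated index `j - 1` in `β` is
harmless because of the factor `j`; the factor `d + j` in front of `p_{m+j,n-j}` completes
`(d+1)_{j-1}` to `(d+1)_j` in `α`. -/
lemma omegaOfGE_eq_pairSum (κ : K) (d n : ℕ) :
    omegaOfGE 2 κ (n + d) n = pairSum κ
      (fun j => poch (-κ) j * poch ((d : K) + 1) j / (poch (κ + d + 1) j * (j.factorial : K)))
      (fun j => poch (-κ) j * poch ((d : K) + 1) (j - 1) * j /
        (poch (κ + d + 1) j * (j.factorial : K))) d n := by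
  have h1 : ((n + d : ℕ) : K) - n = d := by push_cast; ring
  have h2 : κ + ((n + d : ℕ) : K) - n + 1 = κ + d + 1 := by push_cast; ring
  rw [omegaOfGE, pairSum, Finset.sum_range_succ', add_comm, h1, h2]
  congr 1
  · rw [← Finset.Ico_add_one_right_eq_Icc, Finset.sum_Ico_eq_sum_range, Nat.add_sub_cancel]
    refine Finset.sum_congr rfl fun i _ => ?_
    rw [add_comm 1 i, poch_succ ((d : K) + 1), Nat.add_sub_cancel, mul_add, ← mul_assoc, ← mul_assoc, ← map_mul,
      ← map_mul, p_two, p_two]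
    congr 3
    · push_cast; ring
    · ring
  · simp [p_two, poch_zero]

lemma clearedOmega_natCast (d n k : ℕ) (hk : 0 < k) :
    clearedOmega d n (k : K) =
      C (poch (2 * (k : K) + d + 1) n * poch ((k : K) + 1) n * ((n.factorial : K))⁻¹) *
        f (k : K) (n + d) n := by
  have hne : ∀ i : ℕ, (k : K) + d + 1 + i ≠ 0 := fun i => by
    exact_mod_cast (by omega : k + d + 1 + i ≠ 0)
  rw [← C_poch_mul_omegaOfGE _ _ _ hne, omegaOfGE_eq_pairSum, ← div_eq_mul_inv]
  have hp : ∀ j, poch ((k : K) + d + 1) j ≠ 0 := fun j => poch_ne_zero fun i _ => hne i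
  have hfac : ∀ j : ℕ, (j.factorial : K) ≠ 0 := fun j => by exact_mod_cast j.factorial_ne_zero
  refine pairSum_eq k hk _ _ d n (by simp [poch_zero]) (by simp) (fun j => ?_) (fun j => ?_)
  · cases j with
    | zero => simp
    | succ j =>
      rw [Nat.add_sub_cancel, poch_succ ((d : K) + 1)]
      push_cast
      ring
  · have h1 := hp j
    have h2 := hne j
    have h3 := Nat.cast_add_one_ne_zero (R := K) j
    have h4 := hfac j
    rw [Nat.add_sub_cancel, poch_succ (-(k : K)), poch_succ ((k : K) + d + 1), Nat.factorial_succ]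
    push_cast
    field_simp
    ring

namespace IsPolyFun

variable {F G : K → MvPolynomial (Fin 2) K}

lemma edge (u v : Fin 2) (n : ℕ) : IsPolyFun fun κ : K => edge κ u v n := by
  simp only [edge_eq_sum]
  exact sum _ fun ij => (((param.C_add (const _)).C_rising _).mul (const _)).mul
    ((param.C_rising _).mul (const _))

lemma p_two (m n : ℕ) : IsPolyFun fun κ : K => p 2 κ m n := by
  simp only [NonsymmetricJack.p_two]
  exact (edge _ _ _).mul (edge _ _ _)

lemma f (d n : ℕ) : IsPolyFun fun κ : K => f κ (n + d) n := by
  simp only [f_eq]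
  exact (const _).mul (edge _ _ _)

lemma clearedOmega (d n : ℕ) : IsPolyFun fun κ : K => clearedOmega d n κ := by
  have hneg : IsPolyFun fun κ : K => C (-κ) := by
    simpa only [neg_one_mul] using (const (C (-1 : K))).C_mul param
  have hd : IsPolyFun fun κ : K => C (κ + d + 1) := (param.C_add (const _)).C_add (const _)
  refine ((hd.C_poch n).mul (p_two _ _)).add (sum _ fun j => ?_)
  refine IsPolyFun.mul ?_ (((const _).mul (p_two _ _)).add ((const _).mul (p_two _ _)))
  exact (((hneg.C_poch j).C_mul (const _)).C_mul ((hd.C_add (const _)).C_poch _)).C_mul (const _)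

/-- Two functions that depend polynomially on `κ` agree if they agree at the positive integers. -/
lemma eq_of_natCast (hF : IsPolyFun F) (hG : IsPolyFun G)
    (h : ∀ k : ℕ, 0 < k → F (k : K) = G (k : K)) (κ : K) : F κ = G κ := by
  obtain ⟨P, hP⟩ := hF
  obtain ⟨Q, hQ⟩ := hG
  -- In characteristic zero the positive integers give infinitely many points of the domain `K[x₁,
  -- x₂]` at which `P` and `Q` agree.
  have hPQ : P = Q := by
    refine Polynomial.eq_of_infinite_eval_eq P Q ?_
    refine Set.infinite_of_injective_forall_mem
      (f := fun k : ℕ => (C ((k + 1 : ℕ) : K) : MvPolynomial (Fin 2) K)) ?_ ?_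
    · intro i j hij
      have := Nat.cast_injective (R := K) (C_injective _ _ hij)
      omega
    · intro k
      rw [Set.mem_ofPred_eq, ← hP, ← hQ]
      exact h _ k.succ_pos
  rw [hP, hQ, hPQ]

end IsPolyFun

lemma clearedOmega_eq (d n : ℕ) (κ : K) :
    clearedOmega d n κ =
      C (poch (2 * κ + d + 1) n * poch (κ + 1) n * ((n.factorial : K))⁻¹) * f κ (n + d) n := by
  have h2 : IsPolyFun fun κ : K => C (2 * κ + d + 1) :=
    (((IsPolyFun.const _).C_mul IsPolyFun.param).C_add (IsPolyFun.const _)).C_add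
      (IsPolyFun.const _)
  have hG := (((h2.C_poch n).C_mul ((IsPolyFun.param.C_add (IsPolyFun.const (C 1))).C_poch n)).C_mul
    (IsPolyFun.const (C ((n.factorial : K))⁻¹))).mul (IsPolyFun.f d n)
  exact (IsPolyFun.clearedOmega d n).eq_of_natCast hG (fun k hk => clearedOmega_natCast d n k hk) κ

end PolynomialDependence

end NonsymmetricJack

end

theorem mainTheorem5 {K : Type*} [Field K] [CharZero K] (κ : K)
    (hκ : ∀ j : ℕ, 1 ≤ j → κ ≠ -(j : K)) (m n : ℕ) (hmn : n ≤ m) :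
    NonsymmetricJack.omega 2 κ m n =
      MvPolynomial.C
        (NonsymmetricJack.poch (2 * κ + m - n + 1) n * NonsymmetricJack.poch (κ + 1) n /
          (NonsymmetricJack.poch (κ + m - n + 1) n * (n.factorial : K))) *
        NonsymmetricJack.f κ m n := by
  obtain ⟨d, rfl⟩ := Nat.exists_eq_add_of_le hmn
  -- The excluded values of `κ` cover every zero of the cleared denominator `(κ+d+1)_n`.
  have hne : ∀ i : ℕ, κ + d + 1 + i ≠ 0 := fun i h =>
    hκ (d + 1 + i) (by omega) (by push_cast; linear_combination h)
  have hp : NonsymmetricJack.poch (κ + d + 1) n ≠ 0 :=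
    NonsymmetricJack.poch_ne_zero fun i _ => hne i
  have h1 : κ + ((n + d : ℕ) : K) - n + 1 = κ + d + 1 := by push_cast; ring
  have h2 : 2 * κ + ((n + d : ℕ) : K) - n + 1 = 2 * κ + d + 1 := by push_cast; ring
  rw [NonsymmetricJack.omega, if_pos hmn, h1, h2]
  refine mul_left_cancel₀ ((MvPolynomial.C_ne_zero (σ := Fin 2)).2 hp) ?_
  rw [NonsymmetricJack.C_poch_mul_omegaOfGE κ d n hne, NonsymmetricJack.clearedOmega_eq,
    ← mul_assoc, ← map_mul]
  congr 2
  field_simp
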